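/- Let $\omega=\{0,1,2,\dots\}$ carry the discrete topology. A compactification of $\omega$ is a compact Hausdorff space $b\omega$ containing $\omega$ as a dense subspace; its remainder is the subspace $b\omega\setminus\omega$. Let $\mathfrak p$ be the least cardinality of a family $\mathcal F$ of subsets of $\omega$ such that every finite subfamily of $\mathcal F$ has infinite intersection, but there is no infinite $P\subseteq\omega$ with $P\setminus A$ finite for all $A\in\mathcal F$. For a cardinal $\tau$ let $D^\tau$ be the Cantor cube, i.e. the product of $\tau$ copies of the two-point discrete space $D=\{0,1\}$, with the product topology. **Theorem 2.** If $\tau<\mathfrak p$, then any two compactifications of $\omega$ whose remainders are homeomorphic to $D^\tau$ are homeomorphic to each other (as topological spaces). -/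

import Mathlib

universe u v w

/-- A set `P` of natural numbers is a pseudointersection of the family `F` if `P` is infinite and
`P` is almost contained in each member of `F`. -/
def IsPseudointersection (F : Set (Set ℕ)) (P : Set ℕ) : Prop :=
  P.Infinite ∧ ∀ A ∈ F, (P \ A).Finite

/-- The strong finite intersection property: every finite subfamily has infinite intersection
(for one-element subfamilies: every member of the family is infinite). -/
def HasSFIP (F : Set (Set ℕ)) : Prop :=
  ∀ G : Set (Set ℕ), G ⊆ F → G.Finite → (⋂₀ G).Infinite

/-- The families with the strong finite intersection property and no pseudointersection. -/
def badFamilies : Set (Set (Set ℕ)) :=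
  {F | HasSFIP F ∧ ¬ ∃ P, IsPseudointersection F P}

/-- The pseudointersection number: the least cardinality of a family of subsets of `ℕ` that has
the strong finite intersection property and has no pseudointersection. -/
noncomputable def pseudointersectionNumber : Cardinal.{0} :=
  sInf ((fun F : Set (Set ℕ) => Cardinal.mk F) '' badFamilies)

/-- `e : X → K` is a compactification of `X`: `K` is a compact Hausdorff space and `e` is
a topological embedding with dense image. -/
structure IsCompactification {X K : Type*} [TopologicalSpace X] [TopologicalSpace K]
    (e : X → K) : Prop where
  compact : CompactSpace K
  hausdorff : T2Space K
  isEmbedding : Topology.IsEmbedding e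
  denseRange : DenseRange e

/-- The remainder `K \ X` of a compactification `e : X → K`, as a subset of `K`; it carries the
subspace topology. -/
def remainder {X K : Type*} (e : X → K) : Set K := (Set.range e)ᶜ

open Filter Topology

/-! Coordinates of the remainder, identified with `D^ι`, extend to continuous two-valued functions
on the whole compactification. Restricted to `ω` they form a sequence in the cube that meets every
basic clopen set infinitely often. Below `𝔭`, two such sequences agree in each coordinate at almost
all indices, after a permutation of `ω` (`IsIndependentSeq.exists_equiv`). This permutation, glued
to the homeomorphism of the remainders, is continuous because the extended coordinates and the
isolated points determine the topology (`continuous_of_coordinates`). -/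

/-- An indexed family of sets of natural numbers with the strong finite intersection property has
a pseudointersection if its index set is countable. -/
theorem exists_pseudointersection_of_countable {J : Type*} [Countable J] (A : J → Set ℕ)
    (h : ∀ S : Finset J, {m | ∀ i ∈ S, m ∈ A i}.Infinite) :
    ∃ P : Set ℕ, P.Infinite ∧ ∀ i, (P \ A i).Finite := by
  classical
  cases isEmpty_or_nonempty J with
  | inl _ => exact ⟨Set.univ, Set.infinite_univ, fun i => isEmptyElim i⟩
  | inr _ =>
    obtain ⟨s, hs⟩ := exists_surjective_nat J
    obtain ⟨φ, hφ, hA⟩ := extraction_forall_of_frequently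
      (P := fun n k => ∀ i ∈ (Finset.range (n + 1)).image s, k ∈ A i)
      (fun n => Nat.frequently_atTop_iff_infinite.2 (h _))
    refine ⟨Set.range φ, Set.infinite_range_of_injective hφ.injective, fun i => ?_⟩
    obtain ⟨j, rfl⟩ := hs i
    refine ((Set.finite_lt_nat j).image φ).subset ?_
    rintro _ ⟨⟨n, rfl⟩, hn⟩
    refine ⟨n, ?_, rfl⟩
    by_contra hj
    exact hn (hA n _ (Finset.mem_image_of_mem s (by simp at hj ⊢; omega)))

/-- An indexed family of sets of natural numbers with the strong finite intersection property has
a pseudointersection if its index set has cardinality less than the pseudointersection number. -/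
theorem exists_pseudointersection_of_lt {J : Type u}
    (hJ : Cardinal.mk J < Cardinal.lift.{u, 0} pseudointersectionNumber) (A : J → Set ℕ)
    (h : ∀ S : Finset J, {m | ∀ i ∈ S, m ∈ A i}.Infinite) :
    ∃ P : Set ℕ, P.Infinite ∧ ∀ i, (P \ A i).Finite := by
  classical
  by_contra hP
  refine not_le_of_gt hJ ?_
  have hbad : Set.range A ∈ badFamilies := by
    refine ⟨fun G hG hfin => ?_, ?_⟩
    · choose g hg using hG
      have := hfin.fintype
      refine (h (Finset.univ.image fun B : G => g B.2)).mono fun m hm B hB => ?_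
      rw [← hg hB]
      exact hm _ (Finset.mem_image_of_mem (fun B : G => g B.2) (Finset.mem_univ ⟨B, hB⟩))
    · rintro ⟨P, hPi, hPA⟩
      exact hP ⟨P, hPi, fun i => hPA _ ⟨i, rfl⟩⟩
  calc Cardinal.lift.{u, 0} pseudointersectionNumber
      ≤ Cardinal.lift.{u, 0} (Cardinal.mk (Set.range A)) :=
        Cardinal.lift_le.2 (csInf_le' ⟨_, hbad, rfl⟩)
    _ ≤ Cardinal.mk J := by simpa using Cardinal.mk_range_le_lift (f := A)

/-- Fewer than `𝔭` functions on the natural numbers are eventually dominated by one function. -/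
theorem exists_eventually_dominating {ι : Type u}
    (hι : Cardinal.mk ι < Cardinal.lift.{u, 0} pseudointersectionNumber) (h : ι → ℕ → ℕ) :
    ∃ g : ℕ → ℕ, ∀ i, ∀ᶠ n in atTop, h i n ≤ g n := by
  -- Numbers code points of the plane: the sets are the regions above the graphs and the right
  -- half-planes. Monotone majorants let a point further to the right bound the value at `n`.
  let A : ι ⊕ ℕ → Set ℕ := Sum.elim
    (fun i => {c | partialSups (h i) c.unpair.1 ≤ c.unpair.2}) (fun m => {c | m ≤ c.unpair.1})
  have hA : ∀ S : Finset (ι ⊕ ℕ), {c | ∀ i ∈ S, c ∈ A i}.Infinite := fun S => by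
    let a : ℕ → ℕ := fun N => N + S.toRight.sup id
    refine Set.infinite_of_injective_forall_mem
      (f := fun N => Nat.pair (a N) (S.toLeft.sup fun i => partialSups (h i) (a N))) ?_ ?_
    · intro N M hNM
      have := (Nat.pair_eq_pair.1 hNM).1
      simpa [a] using this
    · rintro N (i | m) hi
      · simpa [A] using Finset.le_sup (f := fun i => partialSups (h i) (a N))
          (Finset.mem_toLeft.2 hi)
      · have := Finset.le_sup (f := id) (Finset.mem_toRight.2 hi)
        simp only [id] at this
        simp only [A, a, Sum.elim_inr, Set.mem_ofPred_eq, Nat.unpair_pair]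
        omega
  obtain ⟨P, hP, hPA⟩ : ∃ P : Set ℕ, P.Infinite ∧ ∀ i, (P \ A i).Finite := by
    -- For finite `ι` the index set `ι ⊕ ℕ` is countably infinite, so the bound on `ι` does not pass
    -- to it; diagonalization replaces it.
    cases finite_or_infinite ι with
    | inl _ => exact exists_pseudointersection_of_countable A hA
    | inr _ =>
      refine exists_pseudointersection_of_lt ?_ A hA
      rwa [Cardinal.mk_sum, Cardinal.lift_uzero, Cardinal.mk_nat, Cardinal.lift_aleph0,
        Cardinal.add_eq_left (Cardinal.aleph0_le_mk ι) (Cardinal.aleph0_le_mk ι)]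
  have hc : ∀ n, ∃ c ∈ P, n ≤ c.unpair.1 := fun n => by
    obtain ⟨c, hcP, hc⟩ := (hP.sdiff (hPA (.inr n))).nonempty
    exact ⟨c, hcP, by_contra fun hn => hc ⟨hcP, hn⟩⟩
  choose c hcP hc using hc
  refine ⟨fun n => (c n).unpair.2, fun i => ?_⟩
  obtain ⟨N, hN⟩ := ((hPA (.inl i)).image fun d => d.unpair.1).bddAbove
  filter_upwards [eventually_gt_atTop N] with n hn
  have hmem : c n ∈ A (.inl i) := by
    by_contra hnot
    have := hN ⟨c n, ⟨hcP n, hnot⟩, rfl⟩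
    have := hc n
    simp only at *
    omega
  exact (le_partialSups_of_le (h i) (hc n)).trans hmem

/-- `f` is an independent sequence in the Cantor cube: each basic clopen set contains infinitely
many terms. -/
def IsIndependentSeq {ι : Type*} (f : ℕ → ι → Bool) : Prop :=
  ∀ (x : ι → Bool) (S : Finset ι), {m | ∀ i ∈ S, f m i = x i}.Infinite

/-- Along some infinite `P n` the sequence `g` converges to `f n`. Choosing `φ n` in `P n` beyond a
bound `d n` that eventually dominates the moduli of convergence `b i` serves all coordinates at
once. -/
theorem IsIndependentSeq.exists_injective {ι : Type u}
    (hι : Cardinal.mk ι < Cardinal.lift.{u, 0} pseudointersectionNumber)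
    (f : ℕ → ι → Bool) {g : ℕ → ι → Bool} (hg : IsIndependentSeq g) :
    ∃ φ : ℕ → ℕ, Function.Injective φ ∧ ∀ i, ∀ᶠ n in atTop, g (φ n) i = f n i := by
  choose P hP hPA using fun n => exists_pseudointersection_of_lt hι
    (fun i => {m | g m i = f n i}) (hg (f n))
  have hb : ∀ i n, ∃ b, ∀ m ∈ P n, b ≤ m → g m i = f n i := fun i n => by
    obtain ⟨b, hb⟩ := (hPA n i).bddAbove
    refine ⟨b + 1, fun m hm hbm => ?_⟩
    by_contra hne
    have : m ≤ b := hb ⟨hm, hne⟩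
    omega
  choose b hb using hb
  obtain ⟨d, hd⟩ := exists_eventually_dominating hι b
  obtain ⟨φ, hφ, hφP⟩ := extraction_forall_of_frequently (P := fun n k => k ∈ P n ∧ d n ≤ k)
    (fun n => (Nat.frequently_atTop_iff_infinite.2 (hP n)).and_eventually (eventually_ge_atTop _))
  refine ⟨φ, hφ.injective, fun i => ?_⟩
  filter_upwards [hd i] with n hn
  exact hb i n _ (hφP n).1 (hn.trans (hφP n).2)

/-- Any two independent sequences in a Cantor cube of weight less than `𝔭` agree asymptotically
in each coordinate, up to a permutation of the indices. -/
theorem IsIndependentSeq.exists_equiv {ι : Type u}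
    (hι : Cardinal.mk ι < Cardinal.lift.{u, 0} pseudointersectionNumber)
    {f g : ℕ → ι → Bool} (hf : IsIndependentSeq f) (hg : IsIndependentSeq g) :
    ∃ σ : ℕ ≃ ℕ, ∀ i, ∀ᶠ n in atTop, g (σ n) i = f n i := by
  obtain ⟨φ, hφ, hφi⟩ := hg.exists_injective hι f
  obtain ⟨ψ, hψ, hψi⟩ := hf.exists_injective hι g
  -- Each pair `(n, σ n)` comes from `φ` or from `ψ`, and either origin gives the agreement.
  obtain ⟨σ, hσ, hR⟩ := Function.Embedding.schroeder_bernstein_of_rel hφ hψ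
    (fun n m => m = φ n ∨ n = ψ m) (fun _ => .inl rfl) (fun _ => .inr rfl)
  refine ⟨Equiv.ofBijective σ hσ, fun i => ?_⟩
  have hσt : Tendsto σ atTop atTop := hσ.injective.nat_tendsto_atTop
  filter_upwards [hφi i, hσt.eventually (hψi i)] with n h₁ h₂
  rcases hR n with h | h
  · simpa [h] using h₁
  · rw [← h] at h₂
    simpa using h₂.symm

/-- A set is the disjoint union of the range of an injection and the remainder. -/
noncomputable def sumRemainderEquiv {X K : Type*} {e : X → K} (he : Function.Injective e) :
    X ⊕ remainder e ≃ K :=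
  Equiv.ofBijective (Sum.elim e Subtype.val) <| by
    refine ⟨he.sumElim Subtype.val_injective fun a b hab => b.2 ⟨a, hab⟩, fun k => ?_⟩
    by_cases hk : k ∈ Set.range e
    · obtain ⟨n, rfl⟩ := hk
      exact ⟨.inl n, rfl⟩
    · exact ⟨.inr ⟨k, hk⟩, rfl⟩

namespace IsCompactification

variable {K : Type*} [TopologicalSpace K] {e : ℕ → K}

theorem isOpen_singleton (h : IsCompactification e) (n : ℕ) : IsOpen {e n} := by
  have := h.hausdorff
  obtain ⟨O, hO, hOn⟩ := h.isEmbedding.isOpen_iff.1 (isOpen_discrete ({n} : Set ℕ))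
  have hn : e n ∈ O := by
    have : n ∈ e ⁻¹' O := by simp [hOn]
    exact this
  suffices O = {e n} from this ▸ hO
  refine Set.Subset.antisymm (fun k hk => ?_) (by simpa using hn)
  by_contra hkn
  obtain ⟨m, hm⟩ := h.denseRange.exists_mem_open (hO.sdiff isClosed_singleton) ⟨k, hk, hkn⟩
  have hmn : m ∈ ({n} : Set ℕ) := hOn ▸ hm.1
  exact hm.2 (by rw [Set.mem_singleton_iff.1 hmn]; rfl)

theorem isOpen_of_subset_range (h : IsCompactification e) {s : Set K} (hs : s ⊆ Set.range e) :
    IsOpen s := by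
  rw [← Set.biUnion_of_singleton s]
  refine isOpen_biUnion fun k hk => ?_
  obtain ⟨n, rfl⟩ := hs hk
  exact h.isOpen_singleton n

theorem isClosed_remainder (h : IsCompactification e) : IsClosed (remainder e) :=
  (h.isOpen_of_subset_range subset_rfl).isClosed_compl

/-- A two-valued continuous function on the remainder extends to the compactification. -/
theorem exists_extension (h : IsCompactification e) {c : remainder e → Bool} (hc : Continuous c) :
    ∃ C : K → Bool, Continuous C ∧ ∀ x : remainder e, C x = c x := by
  have := h.compact
  have := h.hausdorff
  have hcl : ∀ b, IsClosed (Subtype.val '' (c ⁻¹' {b})) := fun b =>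
    h.isClosed_remainder.isClosedMap_subtype_val _ ((isClosed_discrete {b}).preimage hc)
  obtain ⟨U, V, hU, hV, htU, hfV, hUV⟩ := normal_separation (hcl true) (hcl false) <| by
    rw [Set.disjoint_image_iff Subtype.val_injective]
    exact Disjoint.preimage _ (by simp)
  have hclopen : IsClopen U := by
    refine ⟨⟨?_⟩, hU⟩
    -- `Uᶜ` is `V` together with isolated points, hence open.
    have : Uᶜ = V ∪ (Uᶜ ∩ Set.range e) := by
      refine Set.Subset.antisymm (fun k hk => ?_) (Set.union_subset
        hUV.subset_compl_left Set.inter_subset_left)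
      by_cases hr : k ∈ Set.range e
      · exact .inr ⟨hk, hr⟩
      · refine .inl (hfV ⟨⟨k, hr⟩, ?_, rfl⟩)
        by_contra hne
        exact hk (htU ⟨⟨k, hr⟩, by simpa using hne, rfl⟩)
    rw [this]
    exact hV.union (h.isOpen_of_subset_range Set.inter_subset_right)
  refine ⟨U.boolIndicator, (continuous_boolIndicator_iff_isClopen U).2 hclopen, fun x => ?_⟩
  cases hx : c x with
  | true => exact (U.mem_iff_boolIndicator x).1 (htU ⟨x, hx, rfl⟩)
  | false =>
    exact (U.notMem_iff_boolIndicator x).1 (hUV.subset_compl_left (hfV ⟨x, hx, rfl⟩))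

theorem exists_extension_pi (h : IsCompactification e) {ι : Type*} {r : remainder e → ι → Bool}
    (hr : Continuous r) :
    ∃ F : K → ι → Bool, Continuous F ∧ ∀ x : remainder e, F x = r x := by
  choose F hF hFr using fun i => h.exists_extension ((continuous_apply i).comp hr)
  exact ⟨fun k i => F i k, continuous_pi hF, fun x => funext fun i => hFr i x⟩

/-- An open set meeting the remainder contains infinitely many points of the dense sequence. -/
theorem infinite_preimage (h : IsCompactification e) {W : Set K} (hW : IsOpen W) {x : K}
    (hx : x ∈ remainder e) (hxW : x ∈ W) : (e ⁻¹' W).Infinite := by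
  have := h.hausdorff
  intro hfin
  obtain ⟨m, hm⟩ := h.denseRange.exists_mem_open
    (hW.sdiff (hfin.image e).isClosed) ⟨x, hxW, fun ⟨n, _, hn⟩ => hx ⟨n, hn⟩⟩
  exact hm.2 ⟨m, hm.1, rfl⟩

/-- A basic clopen set pulls back to an open set meeting the remainder. -/
theorem isIndependentSeq (h : IsCompactification e) {ι : Type*} {F : K → ι → Bool}
    (hF : Continuous F) (hsurj : ∀ y, ∃ x ∈ remainder e, F x = y) :
    IsIndependentSeq (F ∘ e) := by
  intro y S
  obtain ⟨x, hx, rfl⟩ := hsurj y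
  have hW : IsOpen {k | ∀ i ∈ S, F k i = F x i} := by
    simp only [Set.ofPred_forall]
    refine isOpen_biInter_finset fun i _ => ?_
    exact (isOpen_discrete {F x i}).preimage ((continuous_apply i).comp hF)
  exact h.infinite_preimage hW hx fun _ _ => rfl

/-- A function that agrees with a continuous one off finitely many points of the dense sequence
is continuous. -/
theorem continuous_of_eventually_eq (h : IsCompactification e) {Y : Type*} [TopologicalSpace Y]
    {f g : K → Y} (hf : Continuous f) (hr : ∀ k ∈ remainder e, g k = f k)
    (he : ∀ᶠ n in atTop, g (e n) = f (e n)) : Continuous g := by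
  have := h.hausdorff
  rw [← Nat.cofinite_eq_atTop] at he
  refine continuous_iff_continuousAt.2 fun k => ?_
  by_cases hk : k ∈ Set.range e
  · obtain ⟨n, rfl⟩ := hk
    rw [ContinuousAt, (isOpen_singleton_iff_nhds_eq_pure _).1 (h.isOpen_singleton n)]
    exact tendsto_pure_nhds _ _
  · refine hf.continuousAt.congr ?_
    have hnhds := (Set.Finite.image e he).isClosed.isOpen_compl.mem_nhds
      (x := k) (fun ⟨n, _, hn⟩ => hk ⟨n, hn⟩)
    filter_upwards [hnhds] with x hx
    by_cases hxr : x ∈ Set.range e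
    · obtain ⟨n, rfl⟩ := hxr
      by_contra hne
      exact hx ⟨n, fun h' => hne h'.symm, rfl⟩
    · exact (hr x hxr).symm

/-- Continuity into a compactification whose remainder is separated by the functions `F · i` can be
tested on these functions and on the points of the dense sequence. -/
theorem continuous_of_coordinates (h : IsCompactification e) {ι : Type*} {F : K → ι → Bool}
    (hF : Continuous F) (hinj : Set.InjOn F (remainder e)) {X : Type*} [TopologicalSpace X]
    {H : X → K} (hHF : ∀ i, Continuous fun x => F (H x) i)
    (hHe : ∀ n, IsClopen (H ⁻¹' {e n})) : Continuous H := by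
  have := h.compact
  have := h.hausdorff
  -- The indicators of the isolated points make `G` injective, hence an embedding by compactness.
  let G : K → (ι → Bool) × (ℕ → Bool) := fun k => (F k, fun n => ({e n} : Set K).boolIndicator k)
  have hG : Continuous G := hF.prodMk <| continuous_pi fun n =>
    (continuous_boolIndicator_iff_isClopen _).2 ⟨isClosed_singleton, h.isOpen_singleton n⟩
  have hmem : ∀ {k l}, G k = G l → k ∈ Set.range e → k = l := by
    rintro _ l hkl ⟨n, rfl⟩
    have := congrFun (Prod.ext_iff.1 hkl).2 n
    simp only [G] at this
    rw [(Set.mem_iff_boolIndicator _ _).1 (Set.mem_singleton (e n))] at this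
    exact ((Set.mem_iff_boolIndicator _ _).2 this.symm).symm
  have hGi : Function.Injective G := fun k l hkl => by
    by_cases hk : k ∈ Set.range e
    · exact hmem hkl hk
    by_cases hl : l ∈ Set.range e
    · exact (hmem hkl.symm hl).symm
    · exact hinj hk hl (Prod.ext_iff.1 hkl).1
  refine (hG.isClosedEmbedding hGi).isEmbedding.continuous_iff.2 ?_
  exact (continuous_pi hHF).prodMk <| continuous_pi fun n =>
    (continuous_boolIndicator_iff_isClopen _).2 (hHe n)

end IsCompactification

theorem theorem2 (ι : Type u)
    (hι : Cardinal.mk ι < Cardinal.lift.{u, 0} pseudointersectionNumber)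
    (K₁ : Type v) [TopologicalSpace K₁] (e₁ : ℕ → K₁) (h₁ : IsCompactification e₁)
    (r₁ : Nonempty (remainder e₁ ≃ₜ (ι → Bool)))
    (K₂ : Type w) [TopologicalSpace K₂] (e₂ : ℕ → K₂) (h₂ : IsCompactification e₂)
    (r₂ : Nonempty (remainder e₂ ≃ₜ (ι → Bool))) :
    Nonempty (K₁ ≃ₜ K₂) := by
  obtain ⟨r₁⟩ := r₁
  obtain ⟨r₂⟩ := r₂
  have := h₁.compact
  have := h₁.hausdorff
  have := h₂.hausdorff
  obtain ⟨F₁, hF₁, hFr₁⟩ := h₁.exists_extension_pi r₁.continuous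
  obtain ⟨F₂, hF₂, hFr₂⟩ := h₂.exists_extension_pi r₂.continuous
  obtain ⟨σ, hσ⟩ := IsIndependentSeq.exists_equiv hι
    (h₁.isIndependentSeq hF₁ fun y => ⟨_, (r₁.symm y).2, by simp [hFr₁]⟩)
    (h₂.isIndependentSeq hF₂ fun y => ⟨_, (r₂.symm y).2, by simp [hFr₂]⟩)
  let E : K₁ ≃ K₂ := (sumRemainderEquiv h₁.isEmbedding.injective).symm.trans <|
    (Equiv.sumCongr σ (r₁.trans r₂.symm).toEquiv).trans
      (sumRemainderEquiv h₂.isEmbedding.injective)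
  have hEe : ∀ n, E (e₁ n) = e₂ (σ n) := fun n => by
    have : (sumRemainderEquiv h₁.isEmbedding.injective).symm (e₁ n) = .inl n :=
      (Equiv.symm_apply_eq _).2 rfl
    simp only [E, Equiv.trans_apply, this]
    rfl
  have hEr : ∀ k (hk : k ∈ remainder e₁), E k = r₂.symm (r₁ ⟨k, hk⟩) := fun k hk => by
    have : (sumRemainderEquiv h₁.isEmbedding.injective).symm k = .inr ⟨k, hk⟩ :=
      (Equiv.symm_apply_eq _).2 rfl
    simp only [E, Equiv.trans_apply, this]
    rfl
  have hE : Continuous E := by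
    refine h₂.continuous_of_coordinates hF₂ ?_ (fun i => ?_) fun n => ?_
    · intro k hk l hl hkl
      rw [hFr₂ ⟨k, hk⟩, hFr₂ ⟨l, hl⟩] at hkl
      exact congrArg Subtype.val (r₂.injective hkl)
    · refine h₁.continuous_of_eventually_eq (f := fun k => F₁ k i)
        ((continuous_apply i).comp hF₁) (fun k hk => ?_) ?_
      · simp only [hEr k hk, hFr₂, Homeomorph.apply_symm_apply, ← hFr₁ ⟨k, hk⟩]
      · filter_upwards [hσ i] with n hn
        simpa only [hEe, Function.comp_apply] using hn
    · have : E ⁻¹' {e₂ n} = {e₁ (σ.symm n)} := by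
        ext k
        rw [Set.mem_preimage, Set.mem_singleton_iff, Set.mem_singleton_iff, ← E.injective.eq_iff,
          hEe, σ.apply_symm_apply]
      rw [this]
      exact ⟨isClosed_singleton, h₁.isOpen_singleton _⟩
  exact ⟨hE.homeoOfEquivCompactToT2⟩
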